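/- Let $n\ge 1$, let $M\subset\mathbb R^n$ be compact and convex with Euclidean distance $d$, and let $m$ be a Borel probability measure that is absolutely continuous with respect to Lebesgue measure and has support $M$. For $\psi:M\to\mathbb R$ write $\psi^{\mathfrak c}(x)=-\inf_{y\in M}\left[\tfrac12 d(x,y)^2+\psi(y)\right]$ for $x\in M$; a function $\varphi:M\to\mathbb R$ is called $d^2/2$-convex if $\varphi=\psi^{\mathfrak c}$ for some $\psi:M\to\mathbb R$. A Borel map $g:M\to M$ is called an optimal transport map if it minimizes $h\mapsto\int_M d(x,h(x))^2\,m(dx)$ among all Borel maps $h:M\to M$ with $h_*m=g_*m$. A conjugate measure of a probability measure $\mu$ on $M$ is a measure $\mu^{\mathfrak c}$ such that, for some $d^2/2$-convex function $\varphi$, $\mu=(\mathrm{Id}+\nabla\varphi)_*m$ and $\mu^{\mathfrak c}=(\mathrm{Id}+\nabla\varphi^{\mathfrak c})_*m$, where both gradients exist $m$-almost everywhere. Let $\mu=\lambda\delta_z+(1-\lambda)\nu$ with $\lambda\in[0,1]$, $z\in M$ and $\nu$ a Borel probability measure on $M$. Then an optimal transport map $g$ with $g_*m=\mu$ and a conjugate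 measure $\mu^{\mathfrak c}$ of $\mu$ exist, and there is an open (in $\mathbb R^n$) convex set $U\subset M$ with $m(U)=\lambda$ such that (i) every optimal transport map $g$ with $g_*m=\mu$ satisfies $g=z$ $m$-almost everywhere on $U$; (ii) every conjugate measure $\mu^{\mathfrak c}$ of $\mu$ satisfies $\mu^{\mathfrak c}(U)=0$. -/

import Mathlib

open MeasureTheory

/-- `φ` is the generalized Legendre transform (conjugate) of `ψ` on `M`:
`φ x = - inf_{y ∈ M} [d(x, y)² / 2 + ψ y]` for all `x ∈ M`, where the infimum is a real number.
Only the values of `ψ` and `φ` on `M` matter. -/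
def IsConjugateFunction {X : Type*} [MetricSpace X] (M : Set X) (ψ φ : X → ℝ) : Prop :=
  ∀ x ∈ M, IsGLB ((fun y => dist x y ^ 2 / 2 + ψ y) '' M) (-φ x)

/-- `φ` is `d²/2`-convex on `M`: it is the conjugate of some real function on `M`. -/
def IsSqDistConvex {X : Type*} [MetricSpace X] (M : Set X) (φ : X → ℝ) : Prop :=
  ∃ ψ : X → ℝ, IsConjugateFunction M ψ φ

/-- `g` is a Borel map of `M` into itself that minimizes `h ↦ ∫ d(x, h x)² m(dx)` among all
Borel maps `h` of `M` into itself with `h_* m = g_* m` (here `m` is carried by `M`). -/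
def IsOptimalTransportMap {X : Type*} [MetricSpace X] [MeasurableSpace X]
    (M : Set X) (m : Measure X) (g : X → X) : Prop :=
  Measurable g ∧ Set.MapsTo g M M ∧
    ∀ h : X → X, Measurable h → Set.MapsTo h M M → m.map h = m.map g →
      ∫ x, dist x (g x) ^ 2 ∂m ≤ ∫ x, dist x (h x) ^ 2 ∂m

/-- `g = exp (∇φ)` `m`-almost everywhere on a subset `M` of a Euclidean space, where
`exp_x v = x + v`: for `m`-almost every `x`, the function `φ` (restricted to `M`) is differentiable
at `x` with gradient `g x - x`. -/
def IsExpGradient {n : ℕ} (M : Set (EuclideanSpace ℝ (Fin n)))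
    (m : Measure (EuclideanSpace ℝ (Fin n))) (φ : EuclideanSpace ℝ (Fin n) → ℝ)
    (g : EuclideanSpace ℝ (Fin n) → EuclideanSpace ℝ (Fin n)) : Prop :=
  ∀ᵐ x ∂m, HasGradientWithinAt φ (g x - x) M x

/-- `μc` is the conjugate measure of `μ` (with respect to `m` on `M`): for some `d²/2`-convex
function `φ` with conjugate `φc`, `μ` is the push forward of `m` under `exp (∇φ)` and `μc` is the
push forward of `m` under `exp (∇φc)`. -/
def IsConjugateMeasure {n : ℕ} (M : Set (EuclideanSpace ℝ (Fin n)))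
    (m μ μc : Measure (EuclideanSpace ℝ (Fin n))) : Prop :=
  ∃ (φ φc : EuclideanSpace ℝ (Fin n) → ℝ)
    (g gc : EuclideanSpace ℝ (Fin n) → EuclideanSpace ℝ (Fin n)),
    IsSqDistConvex M φ ∧ IsConjugateFunction M φ φc ∧
    Measurable g ∧ IsExpGradient M m φ g ∧ m.map g = μ ∧
    Measurable gc ∧ IsExpGradient M m φc gc ∧ m.map gc = μc

/-!
Conjugate potentials `φ`, `φc` have nonnegative slack `s(x, y) = φ x + φc y + d(x, y)² / 2`. Up to
terms that depend only on `m` and `T_* m`, the cost of a map `T` is twice the integral of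
`s(x, T x)`, so a map whose slack vanishes almost everywhere is optimal and every optimal map with
the same image measure has vanishing slack too. Brenier's theorem provides such potentials through
the minimization of the dual functional.

As `s` is convex in `x`, the set `C = {x | s(x, z) = 0}` is convex. Its mass is at least that of
`T⁻¹{z}`, hence at least `λ`, and its interior meets a suitable ball in a set `U` of mass `λ`. For
fixed `y` the difference `s(x, y) - s(x, z)` is affine in `x` with gradient `z - y`; if
`s(x, y) = 0` for some `x ∈ U`, it has an interior minimum there, so `y = z`. Thus optimal maps send
`U` to `z`. Conversely a map sending `U` to `z` forces `U ⊆ C`, by continuity and because `U` lies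
in the support of `m`, so that `exp (∇φc)` can take a value in `U` only at the point `z`, which is
`m`-null.
-/

open Set Filter Topology
open scoped NNReal ENNReal

section ValueFunction

variable {Y : Type*} [TopologicalSpace Y] [CompactSpace Y]

theorem exists_eq_ciInf_of_compactSpace [Nonempty Y] (f : C(Y, ℝ)) : ∃ y, f y = ⨅ w, f w := by
  obtain ⟨y, -, hy⟩ := isCompact_univ.exists_sInf_image_eq univ_nonempty f.continuous.continuousOn
  exact ⟨y, by rw [← hy, image_univ, sInf_range]⟩

theorem bddBelow_range_of_compactSpace (f : C(Y, ℝ)) : BddBelow (range f) :=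
  (isCompact_range f.continuous).bddBelow

theorem tendsto_of_tendsto_comp_of_compactSpace {Z ι : Type*} [TopologicalSpace Z] [T2Space Z]
    {f : Y → Z} (hf : Continuous f) {y₀ : Y} (hinj : ∀ y, f y = f y₀ → y = y₀) {l : Filter ι}
    {u : ι → Y} (hu : Tendsto (f ∘ u) l (𝓝 (f y₀))) : Tendsto u l (𝓝 y₀) := by
  refine isCompact_univ.tendsto_nhds_of_unique_mapClusterPt
    (Eventually.of_forall fun _ => mem_univ _) fun y _ hy => hinj y ?_
  have hmap : ClusterPt (f y) (map (f ∘ u) l) := hy.continuousAt_comp hf.continuousAt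
  have hcl : ClusterPt (f y) (𝓝 (f y₀)) := hmap.mono hu
  exact eq_of_nhds_neBot hcl

theorem tendsto_minimizer_add_mul (f u : C(Y, ℝ)) {y₀ : Y} (hy₀ : ∀ w, f y₀ ≤ f w)
    (huniq : ∀ y, f y = f y₀ → y = y₀) {y : ℝ → Y}
    (hy : ∀ t w, f (y t) + t * u (y t) ≤ f w + t * u w) : Tendsto y (𝓝 0) (𝓝 y₀) := by
  refine tendsto_of_tendsto_comp_of_compactSpace f.continuous huniq ?_
  have hlim : Tendsto (fun t : ℝ => f y₀ + |t| * (2 * ‖u‖)) (𝓝 0) (𝓝 (f y₀)) := by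
    have : Continuous fun t : ℝ => f y₀ + |t| * (2 * ‖u‖) := by fun_prop
    simpa using this.tendsto 0
  refine tendsto_of_tendsto_of_tendsto_of_le_of_le tendsto_const_nhds hlim
    (fun t => hy₀ _) fun t => ?_
  have hosc : |t * (u y₀ - u (y t))| ≤ |t| * (2 * ‖u‖) := by
    have hu : ∀ w, |u w| ≤ ‖u‖ := u.norm_coe_le_norm
    rw [abs_mul]
    gcongr
    linarith [abs_sub (u y₀) (u (y t)), hu y₀, hu (y t)]
  simp only [Function.comp_apply]
  linarith [hy t y₀, (abs_le.1 hosc).2]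

/-- Danskin's theorem. -/
theorem hasDerivAt_ciInf_add_mul (f u : C(Y, ℝ)) {y₀ : Y} (hy₀ : ∀ w, f y₀ ≤ f w)
    (huniq : ∀ y, f y = f y₀ → y = y₀) :
    HasDerivAt (fun t : ℝ => ⨅ y, (f y + t * u y)) (u y₀) 0 := by
  have : Nonempty Y := ⟨y₀⟩
  choose y hy using fun t : ℝ => exists_eq_ciInf_of_compactSpace (f + t • u)
  have hle : ∀ t w, f (y t) + t * u (y t) ≤ f w + t * u w := fun t w =>
    (hy t).trans_le (ciInf_le (bddBelow_range_of_compactSpace (f + t • u)) w)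
  have hval : ∀ t, ⨅ w, (f w + t * u w) = f (y t) + t * u (y t) := fun t => (hy t).symm
  have hval₀ : ⨅ w, f w = f y₀ :=
    le_antisymm (ciInf_le (bddBelow_range_of_compactSpace f) y₀) (le_ciInf hy₀)
  have hosc : Tendsto (fun t => u (y t) - u y₀) (𝓝 0) (𝓝 0) := by
    simpa using ((u.continuous.tendsto y₀).comp
      (tendsto_minimizer_add_mul f u hy₀ huniq hle)).sub_const (u y₀)
  rw [hasDerivAt_iff_isLittleO_nhds_zero]
  refine (Asymptotics.IsBigO.of_bound' (Eventually.of_forall fun t => ?_)).trans_isLittleO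
    (((Asymptotics.isBigO_refl (fun t : ℝ => t) _).mul_isLittleO
      ((Asymptotics.isLittleO_one_iff ℝ).2 hosc)).congr_right fun t => mul_one t)
  -- The remainder lies between `t * (u (y t) - u y₀)` and `0`.
  simp only [zero_add, zero_mul, add_zero, hval₀]
  rw [hval, smul_eq_mul, Real.norm_eq_abs, Real.norm_eq_abs]
  have h₁ := hle t y₀
  have h₂ := hy₀ (y t)
  rw [abs_of_nonpos (by linarith), abs_of_nonpos (by linarith)]
  linarith

end ValueFunction

theorem isCompact_setOf_lipschitzWith {X : Type*} [PseudoMetricSpace X] [CompactSpace X]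
    (z : X) (R : ℝ≥0) : IsCompact {f : C(X, ℝ) | LipschitzWith R f ∧ f z = 0} := by
  refine ArzelaAscoli.isCompact_of_equicontinuous _ ?_
    (LipschitzWith.uniformEquicontinuous _ R fun f => f.2.1).equicontinuous
  have himage : ContinuousMap.toFun '' {f : C(X, ℝ) | LipschitzWith R f ∧ f z = 0} =
      {f : X → ℝ | LipschitzWith R f ∧ f z = 0} := by
    ext f
    exact ⟨fun ⟨_, hg, hgf⟩ => hgf ▸ hg, fun hf => ⟨⟨f, hf.1.continuous⟩, hf, rfl⟩⟩
  have hclosed : IsClosed {f : X → ℝ | LipschitzWith R f ∧ f z = 0} :=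
    (isClosed_setOfPred_lipschitzWith R).inter
      (isClosed_eq (continuous_apply z) continuous_const)
  rw [himage]
  refine (isCompact_univ_pi fun _ => isCompact_closedBall (0 : ℝ)
    (R * Metric.diam (univ : Set X))).of_isClosed_subset hclosed fun f hf x _ => ?_
  rw [Metric.mem_closedBall, ← hf.2]
  refine (hf.1.dist_le_mul x z).trans (mul_le_mul_of_nonneg_left ?_ R.2)
  exact Metric.dist_le_diam_of_mem isCompact_univ.isBounded (mem_univ _) (mem_univ _)

section Conjugate

variable {X : Type*} [MetricSpace X] {M : Set X} {φ ψ φc : X → ℝ}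

theorem lipschitzOnWith_of_isGLB {ι : Type*} {s : Set X} {p : ι → X} {ψ : ι → ℝ} {R : ℝ≥0}
    (hR : ∀ x ∈ s, ∀ i, dist x (p i) ≤ R)
    (h : ∀ x ∈ s, IsGLB (range fun i => dist x (p i) ^ 2 / 2 + ψ i) (-φ x)) :
    LipschitzOnWith R φ s := by
  refine LipschitzOnWith.of_le_add_mul R fun x hx w hw => ?_
  suffices -φ w - R * dist x w ≤ -φ x by linarith
  refine (h x hx).2 (forall_mem_range.2 fun i => ?_)
  have hw' : -φ w ≤ dist w (p i) ^ 2 / 2 + ψ i := (h w hw).1 (mem_range_self i)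
  have hfac : (dist w (p i) - dist x (p i)) * ((dist w (p i) + dist x (p i)) / 2) ≤
      dist x w * R := by
    refine mul_le_mul ?_ ?_ (by positivity) dist_nonneg
    · linarith [dist_triangle w x (p i), dist_comm w x]
    · linarith [hR x hx i, hR w hw i]
  linarith

/-- The slack in the constraint `φ x + ψ y ≥ -d(x, y)² / 2` of the dual transport problem. It is
nonnegative for conjugate potentials, and transport only takes place where it vanishes. -/
noncomputable def dualSlack (φ ψ : X → ℝ) (x y : X) : ℝ :=
  φ x + ψ y + dist x y ^ 2 / 2

theorem dualSlack_comm (φ ψ : X → ℝ) (x y : X) : dualSlack φ ψ x y = dualSlack ψ φ y x := by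
  rw [dualSlack, dualSlack, dist_comm, add_comm (φ x)]

/-- The set of points of `M` which the potentials `φ`, `ψ` allow to be transported to `z`. -/
def contactSet (M : Set X) (φ ψ : X → ℝ) (z : X) : Set X :=
  {x ∈ M | dualSlack φ ψ x z = 0}

namespace IsConjugateFunction

theorem dualSlack_nonneg (h : IsConjugateFunction M ψ φ) {x y : X} (hx : x ∈ M) (hy : y ∈ M) :
    0 ≤ dualSlack φ ψ x y := by
  have : -φ x ≤ dist x y ^ 2 / 2 + ψ y := (h x hx).1 (mem_image_of_mem _ hy)
  rw [dualSlack]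
  linarith

theorem le_of_forall (h : IsConjugateFunction M ψ φ) {x : X} (hx : x ∈ M) {t : ℝ}
    (ht : ∀ y ∈ M, 0 ≤ t + ψ y + dist x y ^ 2 / 2) : φ x ≤ t :=
  neg_le_neg_iff.1 ((h x hx).2 (forall_mem_image.2 fun y hy => by linarith [ht y hy]))

theorem continuousOn (h : IsConjugateFunction M ψ φ) (hM : Bornology.IsBounded M) :
    ContinuousOn φ M :=
  (lipschitzOnWith_of_isGLB (p := ((↑) : M → X)) (R := ⟨Metric.diam M, Metric.diam_nonneg⟩)
    (fun _ hx y => Metric.dist_le_diam_of_mem hM hx y.2)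
    fun x hx => by simpa only [image_eq_range] using h x hx).continuousOn

theorem biconjugate (h : IsConjugateFunction M ψ φ) (h' : IsConjugateFunction M φ φc) :
    IsConjugateFunction M φc φ := by
  refine fun x hx => ⟨forall_mem_image.2 fun y hy => ?_, fun t ht => ?_⟩
  · have := h'.dualSlack_nonneg hy hx
    rw [dualSlack, dist_comm] at this
    linarith
  · refine (h x hx).2 (forall_mem_image.2 fun y hy => ?_)
    have hφcψ : φc y ≤ ψ y := h'.le_of_forall hy fun w hw => by
      have := h.dualSlack_nonneg hw hy
      rw [dualSlack, dist_comm] at this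
      linarith
    have : t ≤ dist x y ^ 2 / 2 + φc y := ht (mem_image_of_mem _ hy)
    linarith

end IsConjugateFunction

/-- The function `y ↦ d(x, y)² / 2 + ψ y` on `M` whose infimum defines the conjugate of `ψ` at the
point `x`, which need not lie in `M`. -/
noncomputable def augmentedCost (ψ : C(M, ℝ)) (x : X) : C(M, ℝ) where
  toFun y := dist x y ^ 2 / 2 + ψ y

/-- The conjugate of a continuous function `ψ` on `M`, as a function on the whole space. -/
noncomputable def sqDistConjugate (ψ : C(M, ℝ)) (x : X) : ℝ :=
  -⨅ y, augmentedCost ψ x y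

variable [CompactSpace M]

theorem neg_sqDistConjugate_le (ψ : C(M, ℝ)) (x : X) (y : M) :
    -sqDistConjugate ψ x ≤ dist x y ^ 2 / 2 + ψ y := by
  rw [sqDistConjugate, neg_neg]
  exact ciInf_le (bddBelow_range_of_compactSpace (augmentedCost ψ x)) y

theorem hasDerivAt_sqDistConjugate_add_smul (ψ u : C(M, ℝ)) {x : X} {y₀ : M}
    (hy₀ : dist x y₀ ^ 2 / 2 + ψ y₀ = -sqDistConjugate ψ x)
    (huniq : ∀ y : M, dist x y ^ 2 / 2 + ψ y = -sqDistConjugate ψ x → y = y₀) :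
    HasDerivAt (fun t : ℝ => sqDistConjugate (ψ + t • u) x) (-u y₀) 0 := by
  have h := hasDerivAt_ciInf_add_mul (augmentedCost ψ x) u
    (fun w => hy₀.trans_le (neg_sqDistConjugate_le ψ x w)) fun y hy => huniq y (hy.trans hy₀)
  refine h.neg.congr_of_eventuallyEq (Eventually.of_forall fun t => ?_)
  simp [sqDistConjugate, augmentedCost, add_assoc]

variable [Nonempty M]

theorem exists_eq_neg_sqDistConjugate (ψ : C(M, ℝ)) (x : X) :
    ∃ y : M, dist x y ^ 2 / 2 + ψ y = -sqDistConjugate ψ x := by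
  rw [sqDistConjugate, neg_neg]
  exact exists_eq_ciInf_of_compactSpace (augmentedCost ψ x)

theorem sqDistConjugate_le_iff {ψ : C(M, ℝ)} {x : X} {t : ℝ} :
    sqDistConjugate ψ x ≤ t ↔ ∀ y : M, -t ≤ dist x y ^ 2 / 2 + ψ y := by
  refine ⟨fun h y => (neg_le_neg h).trans (neg_sqDistConjugate_le ψ x y), fun h => ?_⟩
  obtain ⟨y, hy⟩ := exists_eq_neg_sqDistConjugate ψ x
  linarith [h y]

theorem isGLB_neg_sqDistConjugate (ψ : C(M, ℝ)) (x : X) :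
    IsGLB (range fun y : M => dist x y ^ 2 / 2 + ψ y) (-sqDistConjugate ψ x) :=
  ⟨forall_mem_range.2 (neg_sqDistConjugate_le ψ x), fun t ht =>
    le_neg_of_le_neg (sqDistConjugate_le_iff.2 fun y => by
      rw [neg_neg]; exact ht (mem_range_self y))⟩

theorem isConjugateFunction_sqDistConjugate {f : X → ℝ} {ψ : C(M, ℝ)} (hf : ∀ y : M, f y = ψ y) :
    IsConjugateFunction M f (sqDistConjugate ψ) := fun x _ => by
  simpa only [image_eq_range, hf] using isGLB_neg_sqDistConjugate ψ x

theorem exists_lipschitzOnWith_sqDistConjugate {s : Set X} (hs : Bornology.IsBounded s) :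
    ∃ R : ℝ≥0, ∀ ψ : C(M, ℝ), LipschitzOnWith R (sqDistConjugate ψ) s := by
  have hsM : Bornology.IsBounded (s ∪ M) :=
    hs.union (isCompact_iff_compactSpace.2 ‹CompactSpace M›).isBounded
  exact ⟨⟨Metric.diam (s ∪ M), Metric.diam_nonneg⟩, fun ψ => lipschitzOnWith_of_isGLB
    (fun x hx y => Metric.dist_le_diam_of_mem hsM (Or.inl hx) (Or.inr y.2))
    fun x _ => isGLB_neg_sqDistConjugate ψ x⟩

theorem continuous_sqDistConjugate (ψ : C(M, ℝ)) : Continuous (sqDistConjugate ψ) :=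
  continuous_iff_continuousAt.2 fun x =>
    have ⟨_, hR⟩ := exists_lipschitzOnWith_sqDistConjugate (M := M) (Metric.isBounded_ball (x := x))
    (hR ψ).continuousOn.continuousAt (Metric.ball_mem_nhds x one_pos)

/-- The conjugate of `ψ`, restricted to `M`. -/
noncomputable def sqDistConjugateOn (ψ : C(M, ℝ)) : C(M, ℝ) where
  toFun x := sqDistConjugate ψ x
  continuous_toFun := (continuous_sqDistConjugate ψ).comp continuous_subtype_val

theorem sqDistConjugateOn_sqDistConjugateOn_le (ψ : C(M, ℝ)) (y : M) :
    sqDistConjugateOn (sqDistConjugateOn ψ) y ≤ ψ y :=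
  sqDistConjugate_le_iff.2 fun x => by
    have := neg_sqDistConjugate_le ψ x y
    rw [dist_comm]
    change -ψ y ≤ dist (x : X) y ^ 2 / 2 + sqDistConjugate ψ x
    linarith

theorem sqDistConjugate_add_const (ψ : C(M, ℝ)) (k : ℝ) (x : X) :
    sqDistConjugate (ψ + .const M k) x = sqDistConjugate ψ x - k := by
  refine eq_of_forall_ge_iff fun t => ?_
  rw [sub_le_iff_le_add, sqDistConjugate_le_iff, sqDistConjugate_le_iff]
  refine forall_congr' fun y => ?_
  rw [ContinuousMap.add_apply, ContinuousMap.const_apply]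
  constructor <;> intro h <;> linarith

theorem lipschitzWith_sqDistConjugate_apply (x : X) :
    LipschitzWith 1 fun ψ : C(M, ℝ) => sqDistConjugate ψ x := by
  refine LipschitzWith.of_le_add fun ψ ψ' => sqDistConjugate_le_iff.2 fun y => ?_
  have h₁ := neg_sqDistConjugate_le ψ' x y
  have h₂ := (abs_le.1 (ContinuousMap.dist_apply_le_dist (f := ψ) (g := ψ') y)).1
  linarith

theorem lipschitzWith_sqDistConjugate_add_smul (ψ u : C(M, ℝ)) (x : X) :
    LipschitzWith (Real.nnabs ‖u‖) fun t : ℝ => sqDistConjugate (ψ + t • u) x := by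
  have hline : LipschitzWith (Real.nnabs ‖u‖) fun t : ℝ => ψ + t • u :=
    LipschitzWith.of_dist_le_mul fun s t => by
      rw [dist_add_left, dist_eq_norm, ← sub_smul, norm_smul, Real.dist_eq, mul_comm]
      simp
  have := (lipschitzWith_sqDistConjugate_apply x).comp hline
  rwa [one_mul] at this

end Conjugate

section DualProblem

theorem lipschitzWith_integral_of_lipschitzWith {Ω α : Type*} [MeasurableSpace Ω]
    [PseudoMetricSpace α] {P : Measure Ω} [IsProbabilityMeasure P] {F : α → Ω → ℝ}
    (hint : ∀ a, Integrable (F a) P) (hF : ∀ ω, LipschitzWith 1 fun a => F a ω) :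
    LipschitzWith 1 fun a => ∫ ω, F a ω ∂P := by
  refine LipschitzWith.of_le_add fun a b => ?_
  calc ∫ ω, F a ω ∂P ≤ ∫ ω, (F b ω + dist a b) ∂P :=
        integral_mono (hint a) ((hint b).add (integrable_const _)) fun ω =>
          sub_le_iff_le_add'.1 ((le_abs_self _).trans
            ((hF ω).dist_le_mul a b |>.trans_eq (by simp)))
    _ = ∫ ω, F b ω ∂P + dist a b := by
        rw [integral_add (hint b) (integrable_const _), integral_const, probReal_univ, one_smul]

variable {X : Type*} [MetricSpace X] [MeasurableSpace X] [BorelSpace X] {M : Set X}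
  {m : Measure X}

theorem integrable_of_continuousOn_isCompact [IsFiniteMeasureOnCompacts m] (hMc : IsCompact M)
    (hm : m Mᶜ = 0) {f : X → ℝ} (hf : ContinuousOn f M) : Integrable f m := by
  have := hf.integrableOn_compact (μ := m) hMc
  rwa [IntegrableOn, Measure.restrict_eq_self_of_ae_mem (mem_ae_iff.2 hm)] at this

variable [CompactSpace M] {κ : Measure M}

theorem integrable_continuousMap [IsFiniteMeasure κ] (ψ : C(M, ℝ)) : Integrable ψ κ :=
  ψ.continuous.integrable_of_hasCompactSupport (.of_compactSpace _)

theorem hasDerivAt_integral_add_smul [IsFiniteMeasure κ] (ψ u : C(M, ℝ)) :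
    HasDerivAt (fun t : ℝ => ∫ y, (ψ + t • u) y ∂κ) (∫ y, u y ∂κ) 0 := by
  have heq : (fun t : ℝ => ∫ y, (ψ + t • u) y ∂κ) =
      fun t => ∫ y, ψ y ∂κ + t * ∫ y, u y ∂κ := funext fun t => by
    rw [← integral_const_mul, ← integral_add (integrable_continuousMap ψ)
      ((integrable_continuousMap u).const_mul t)]
    rfl
  rw [heq]
  simpa using ((hasDerivAt_id (0 : ℝ)).mul_const (∫ y, u y ∂κ)).const_add (∫ y, ψ y ∂κ)

/-- The objective of the dual Kantorovich problem for the marginals `m` and `κ`, reduced to its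
second potential. -/
noncomputable def dualObjective (m : Measure X) (κ : Measure M) (ψ : C(M, ℝ)) : ℝ :=
  ∫ x, sqDistConjugate ψ x ∂m + ∫ y, ψ y ∂κ

variable [Nonempty M]

theorem integrable_sqDistConjugate [IsFiniteMeasure m] (hm : m Mᶜ = 0) (ψ : C(M, ℝ)) :
    Integrable (sqDistConjugate ψ) m :=
  integrable_of_continuousOn_isCompact (isCompact_iff_compactSpace.2 ‹CompactSpace M›) hm
    (continuous_sqDistConjugate ψ).continuousOn

variable [IsProbabilityMeasure m] [IsProbabilityMeasure κ]

theorem continuous_dualObjective (hm : m Mᶜ = 0) : Continuous (dualObjective m κ) :=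
  (lipschitzWith_integral_of_lipschitzWith (integrable_sqDistConjugate hm)
      lipschitzWith_sqDistConjugate_apply).continuous.add
    (lipschitzWith_integral_of_lipschitzWith integrable_continuousMap fun y =>
      LipschitzWith.mk_one fun _ _ => ContinuousMap.dist_apply_le_dist y).continuous

theorem dualObjective_add_const (hm : m Mᶜ = 0) (ψ : C(M, ℝ)) (k : ℝ) :
    dualObjective m κ (ψ + .const M k) = dualObjective m κ ψ := by
  simp only [dualObjective, sqDistConjugate_add_const, ContinuousMap.add_apply,
    ContinuousMap.const_apply]
  rw [integral_sub (integrable_sqDistConjugate hm ψ) (integrable_const _),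
    integral_add (integrable_continuousMap ψ) (integrable_const _)]
  simp only [integral_const, probReal_univ, one_smul]
  ring

theorem dualObjective_biconjugate_le (hm : m Mᶜ = 0) (ψ : C(M, ℝ)) :
    dualObjective m κ (sqDistConjugateOn (sqDistConjugateOn ψ)) ≤ dualObjective m κ ψ := by
  refine add_le_add (integral_mono_ae (integrable_sqDistConjugate hm _)
    (integrable_sqDistConjugate hm _) ?_) (integral_mono (integrable_continuousMap _)
    (integrable_continuousMap _) (sqDistConjugateOn_sqDistConjugateOn_le ψ))
  filter_upwards [mem_ae_iff.2 hm] with x hx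
  exact sqDistConjugateOn_sqDistConjugateOn_le (sqDistConjugateOn ψ) ⟨x, hx⟩

theorem exists_dualObjective_minimizer (hm : m Mᶜ = 0) (κ : Measure M) [IsProbabilityMeasure κ] :
    ∃ ψ : C(M, ℝ), ∀ ψ', dualObjective m κ ψ ≤ dualObjective m κ ψ' := by
  -- The biconjugate of a competitor, normalized to vanish at `z`, is at least as good, and it is
  -- Lipschitz with a constant `R` that only depends on `M`.
  obtain ⟨z⟩ := ‹Nonempty M›
  obtain ⟨R, hR⟩ := exists_lipschitzOnWith_sqDistConjugate (M := M)
    (isCompact_iff_compactSpace.2 ‹CompactSpace M›).isBounded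
  obtain ⟨ψ, -, hψ⟩ := (isCompact_setOf_lipschitzWith z R).exists_isMinOn
    ⟨0, LipschitzWith.const' (0 : ℝ), rfl⟩ (continuous_dualObjective (κ := κ) hm).continuousOn
  refine ⟨ψ, fun ψ' => ?_⟩
  set ψcc := sqDistConjugateOn (sqDistConjugateOn ψ')
  have hlip : LipschitzWith R ψcc := (hR _).to_restrict
  calc dualObjective m κ ψ ≤ dualObjective m κ (ψcc + .const M (-ψcc z)) :=
        hψ ⟨by rw [← add_zero R]; exact hlip.add (LipschitzWith.const _), by simp⟩
    _ = dualObjective m κ ψcc := dualObjective_add_const hm _ _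
    _ ≤ dualObjective m κ ψ' := dualObjective_biconjugate_le hm ψ'

theorem hasDerivAt_dualObjective_add_smul (hm : m Mᶜ = 0) {ψ : C(M, ℝ)} {T : X → X}
    (hT : Measurable T)
    (hmin : ∀ᵐ (x : X) ∂m, ∀ y : M,
      dist x y ^ 2 / 2 + ψ y = -sqDistConjugate ψ x → (y : X) = T x)
    (f : C(X, ℝ)) :
    HasDerivAt (fun t : ℝ => dualObjective m κ (ψ + t • f.restrict M))
      (-∫ x, f (T x) ∂m + ∫ y : M, f y ∂κ) 0 := by
  set u : C(M, ℝ) := f.restrict M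
  have hderiv : ∀ᵐ x ∂m,
      HasDerivAt (fun t : ℝ => sqDistConjugate (ψ + t • u) x) (-f (T x)) 0 := by
    filter_upwards [hmin] with x hx
    obtain ⟨y, hy⟩ := exists_eq_neg_sqDistConjugate ψ x
    have hTx : f (T x) = u y := by rw [← hx y hy]; rfl
    rw [hTx]
    exact hasDerivAt_sqDistConjugate_add_smul ψ u hy fun w hw =>
      Subtype.ext ((hx w hw).trans (hx y hy).symm)
  have hconj := (hasDerivAt_integral_of_dominated_loc_of_lip (μ := m) (bound := fun _ => ‖u‖)
    (F' := fun x => -f (T x)) (F := fun (t : ℝ) x => sqDistConjugate (ψ + t • u) x) univ_mem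
    (Eventually.of_forall fun t => (integrable_sqDistConjugate hm _).aestronglyMeasurable)
    (integrable_sqDistConjugate hm _)
    (f.continuous.measurable.comp hT).neg.aestronglyMeasurable
    (Eventually.of_forall fun x => (lipschitzWith_sqDistConjugate_add_smul ψ u x).lipschitzOnWith)
    (integrable_const _) hderiv).2
  rw [← integral_neg]
  exact hconj.add (hasDerivAt_integral_add_smul ψ u)

theorem map_eq_of_dualObjective_minimizer (hm : m Mᶜ = 0) {ψ : C(M, ℝ)}
    (hψ : ∀ ψ', dualObjective m κ ψ ≤ dualObjective m κ ψ') {T : X → X} (hT : Measurable T)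
    (hmin : ∀ᵐ (x : X) ∂m, ∀ y : M,
      dist x y ^ 2 / 2 + ψ y = -sqDistConjugate ψ x → (y : X) = T x) :
    m.map T = κ.map (↑) := by
  refine ext_of_forall_integral_eq_of_IsFiniteMeasure fun f => ?_
  have hzero := (IsLocalMin.hasDerivAt_eq_zero (a := (0 : ℝ)) (Eventually.of_forall fun t => by
    simpa using hψ (ψ + t • (f : C(X, ℝ)).restrict M))
    (hasDerivAt_dualObjective_add_smul (κ := κ) hm hT hmin f))
  rw [integral_map hT.aemeasurable f.continuous.aestronglyMeasurable,
    integral_map measurable_subtype_coe.aemeasurable f.continuous.aestronglyMeasurable]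
  exact neg_add_eq_zero.1 hzero

end DualProblem

section DualCertificate

theorem eq_of_ae_restrict_eq_of_subset_support {X Y : Type*} [TopologicalSpace X]
    [MeasurableSpace X] [OpensMeasurableSpace X] [TopologicalSpace Y] [T1Space Y]
    {m : Measure X} {U : Set X} {f : X → Y} {c : Y} (hU : IsOpen U) (hf : ContinuousOn f U)
    (hUm : U ⊆ m.support) (hfc : ∀ᵐ x ∂(m.restrict U), f x = c) {x : X} (hx : x ∈ U) :
    f x = c := by
  by_contra hne
  have hopen : IsOpen (U ∩ f ⁻¹' {c}ᶜ) := hf.isOpen_inter_preimage hU isOpen_compl_singleton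
  refine Measure.subset_compl_support_of_isOpen hopen ?_ ⟨hx, hne⟩ (hUm hx)
  rw [inter_comm, ← Measure.restrict_apply' hU.measurableSet]
  exact hfc

variable {X : Type*} [MetricSpace X] [MeasurableSpace X]

/-- Complementary slackness for the transport of `m` by `T`: the potentials `φ` and `ψ` are
conjugate to each other on `M`, and `T` moves almost every point along a pair at which the dual
constraint is tight. -/
structure IsDualCertificate (M : Set X) (m : Measure X) (φ ψ : X → ℝ) (T : X → X) : Prop where
  isConjugateFunction_left : IsConjugateFunction M ψ φ
  isConjugateFunction_right : IsConjugateFunction M φ ψ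
  measurable : Measurable T
  mapsTo : MapsTo T M M
  dualSlack_eq_zero : ∀ᵐ x ∂m, dualSlack φ ψ x (T x) = 0

namespace IsDualCertificate

variable [BorelSpace X] {M U : Set X} {m : Measure X} {φ ψ : X → ℝ} {g : X → X} {z : X}

theorem map_singleton_le (h : IsDualCertificate M m φ ψ g) (hm : m Mᶜ = 0) :
    m.map g {z} ≤ m (contactSet M φ ψ z) := by
  rw [Measure.map_apply h.measurable (measurableSet_singleton z)]
  refine measure_mono_ae ?_
  filter_upwards [h.dualSlack_eq_zero, mem_ae_iff.2 hm] with x hx hxM (hxz : g x = z)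
  exact ⟨hxM, hxz ▸ hx⟩

theorem subset_contactSet (h : IsDualCertificate M m φ ψ g) (hM : Bornology.IsBounded M)
    (hU : IsOpen U) (hUM : U ⊆ M) (hUm : U ⊆ m.support)
    (hg : ∀ᵐ x ∂(m.restrict U), g x = z) : U ⊆ contactSet M φ ψ z := by
  have hcont : ContinuousOn (fun x => dualSlack φ ψ x z) U :=
    (((h.isConjugateFunction_left.continuousOn hM).mono hUM).add continuousOn_const).add
      (by fun_prop)
  refine fun x hx => ⟨hUM hx, eq_of_ae_restrict_eq_of_subset_support hU hcont hUm ?_ hx⟩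
  filter_upwards [hg, ae_restrict_of_ae h.dualSlack_eq_zero] with w hw hslack
  rwa [hw] at hslack

end IsDualCertificate

end DualCertificate

section Optimality

theorem map_compl_eq_zero_of_mapsTo {X : Type*} [MeasurableSpace X] {M : Set X}
    {m : Measure X} {h : X → X} (hM : MeasurableSet M) (hm : m Mᶜ = 0) (hh : Measurable h)
    (hhM : MapsTo h M M) : m.map h Mᶜ = 0 := by
  rw [Measure.map_apply hh hM.compl]
  exact measure_mono_null (fun x hx hxM => hx (hhM hxM)) hm

variable {X : Type*} [MetricSpace X] [MeasurableSpace X] {M : Set X} {m : Measure X}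
  {φ ψ : X → ℝ} {g h : X → X}

theorem IsConjugateFunction.ae_dualSlack_nonneg (hψφ : IsConjugateFunction M ψ φ)
    (hm : m Mᶜ = 0) (hhM : MapsTo h M M) : 0 ≤ᵐ[m] fun x => dualSlack φ ψ x (h x) := by
  filter_upwards [mem_ae_iff.2 hm] with x hx
  exact hψφ.dualSlack_nonneg hx (hhM hx)

variable [BorelSpace X] [IsFiniteMeasure m]

theorem integrable_comp_of_mapsTo (hMc : IsCompact M) (hm : m Mᶜ = 0) (hψ : ContinuousOn ψ M)
    (hh : Measurable h) (hhM : MapsTo h M M) : Integrable ψ (m.map h) :=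
  integrable_of_continuousOn_isCompact hMc
    (map_compl_eq_zero_of_mapsTo hMc.measurableSet hm hh hhM) hψ

variable [SecondCountableTopology X]

theorem integrable_dist_sq (hMc : IsCompact M) (hm : m Mᶜ = 0) (hh : Measurable h)
    (hhM : MapsTo h M M) : Integrable (fun x => dist x (h x) ^ 2) m := by
  refine Integrable.of_bound ((measurable_id.dist hh).pow_const 2).aestronglyMeasurable
    (Metric.diam M ^ 2) ?_
  filter_upwards [mem_ae_iff.2 hm] with x hx
  rw [norm_pow, Real.norm_of_nonneg dist_nonneg]
  gcongr
  exact Metric.dist_le_diam_of_mem hMc.isBounded hx (hhM hx)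

theorem integrable_dualSlack (hMc : IsCompact M) (hm : m Mᶜ = 0) (hφ : ContinuousOn φ M)
    (hψ : ContinuousOn ψ M) (hh : Measurable h) (hhM : MapsTo h M M) :
    Integrable (fun x => dualSlack φ ψ x (h x)) m :=
  ((integrable_of_continuousOn_isCompact hMc hm hφ).add
    ((integrable_comp_of_mapsTo hMc hm hψ hh hhM).comp_measurable hh)).add
    ((integrable_dist_sq hMc hm hh hhM).div_const 2)

theorem integral_dualSlack (hMc : IsCompact M) (hm : m Mᶜ = 0) (hφ : ContinuousOn φ M)
    (hψ : ContinuousOn ψ M) (hh : Measurable h) (hhM : MapsTo h M M) :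
    ∫ x, dualSlack φ ψ x (h x) ∂m =
      ∫ x, φ x ∂m + ∫ y, ψ y ∂(m.map h) + (∫ x, dist x (h x) ^ 2 ∂m) / 2 := by
  have hφi := integrable_of_continuousOn_isCompact hMc hm hφ
  have hψi := integrable_comp_of_mapsTo hMc hm hψ hh hhM
  have hψh : Integrable (fun x => ψ (h x)) m := hψi.comp_measurable hh
  rw [integral_map hh.aemeasurable hψi.aestronglyMeasurable, ← integral_div,
    ← integral_add hφi hψh]
  exact integral_add (hφi.add hψh)
    ((integrable_dist_sq hMc hm hh hhM).div_const 2)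

theorem integral_dist_sq_le_iff (hMc : IsCompact M) (hm : m Mᶜ = 0) (hφ : ContinuousOn φ M)
    (hψ : ContinuousOn ψ M) (hg : Measurable g) (hgM : MapsTo g M M) (hh : Measurable h)
    (hhM : MapsTo h M M) (hmap : m.map h = m.map g) :
    ∫ x, dist x (g x) ^ 2 ∂m ≤ ∫ x, dist x (h x) ^ 2 ∂m ↔
      ∫ x, dualSlack φ ψ x (g x) ∂m ≤ ∫ x, dualSlack φ ψ x (h x) ∂m := by
  rw [integral_dualSlack hMc hm hφ hψ hg hgM, integral_dualSlack hMc hm hφ hψ hh hhM, hmap,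
    add_le_add_iff_left, div_le_div_iff_of_pos_right two_pos]

namespace IsDualCertificate

theorem isOptimalTransportMap (hg : IsDualCertificate M m φ ψ g) (hMc : IsCompact M)
    (hm : m Mᶜ = 0) : IsOptimalTransportMap M m g := by
  refine ⟨hg.measurable, hg.mapsTo, fun h hh hhM hmap => ?_⟩
  rw [integral_dist_sq_le_iff hMc hm (hg.isConjugateFunction_left.continuousOn hMc.isBounded)
    (hg.isConjugateFunction_right.continuousOn hMc.isBounded) hg.measurable hg.mapsTo hh hhM hmap,
    integral_eq_zero_of_ae hg.dualSlack_eq_zero]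
  exact integral_nonneg_of_ae (hg.isConjugateFunction_left.ae_dualSlack_nonneg hm hhM)

theorem of_isOptimalTransportMap (hg : IsDualCertificate M m φ ψ g) (hMc : IsCompact M)
    (hm : m Mᶜ = 0) (hh : IsOptimalTransportMap M m h) (hmap : m.map h = m.map g) :
    IsDualCertificate M m φ ψ h := by
  refine ⟨hg.isConjugateFunction_left, hg.isConjugateFunction_right, hh.1, hh.2.1, ?_⟩
  have hφ := hg.isConjugateFunction_left.continuousOn hMc.isBounded
  have hψ := hg.isConjugateFunction_right.continuousOn hMc.isBounded
  have hle := (integral_dist_sq_le_iff hMc hm hφ hψ hh.1 hh.2.1 hg.measurable hg.mapsTo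
    hmap.symm).1 (hh.2.2 g hg.measurable hg.mapsTo hmap.symm)
  rw [integral_eq_zero_of_ae hg.dualSlack_eq_zero] at hle
  have hnonneg := hg.isConjugateFunction_left.ae_dualSlack_nonneg hm hh.2.1
  exact (integral_eq_zero_iff_of_nonneg_ae hnonneg
    (integrable_dualSlack hMc hm hφ hψ hh.1 hh.2.1)).1
    (hle.antisymm (integral_nonneg_of_ae hnonneg))

end IsDualCertificate

end Optimality

section InnerProductSpace

variable {E : Type*} [NormedAddCommGroup E] [InnerProductSpace ℝ E] {M : Set E} {φ ψ φc : E → ℝ}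

theorem dist_sq_sub_dist_sq_eq (x y z : E) :
    dist x y ^ 2 - dist x z ^ 2 = 2 * inner ℝ x (z - y) + (‖y‖ ^ 2 - ‖z‖ ^ 2) := by
  rw [dist_eq_norm, dist_eq_norm, norm_sub_sq_real, norm_sub_sq_real, inner_sub_right]
  ring

theorem IsConjugateFunction.convexOn_dualSlack (h : IsConjugateFunction M ψ φ)
    (hM : Convex ℝ M) (η : E → ℝ) (z : E) : ConvexOn ℝ M fun x => dualSlack φ η x z := by
  -- `x ↦ φ x + d(x, z)² / 2` is a supremum of the affine functions `haff`.
  refine ⟨hM, fun x hx w hw s t hs ht hst => ?_⟩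
  have hφ : φ (s • x + t • w) ≤ s * (φ x + dist x z ^ 2 / 2) + t * (φ w + dist w z ^ 2 / 2) -
      dist (s • x + t • w) z ^ 2 / 2 := by
    refine h.le_of_forall (hM hx hw hs ht hst) fun y hy => ?_
    have hxy := mul_nonneg hs (h.dualSlack_nonneg hx hy)
    have hwy := mul_nonneg ht (h.dualSlack_nonneg hw hy)
    have haff := dist_sq_sub_dist_sq_eq (s • x + t • w) y z
    rw [inner_add_left, real_inner_smul_left, real_inner_smul_left] at haff
    obtain rfl : t = 1 - s := by linarith
    rw [dualSlack] at hxy hwy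
    linear_combination hxy + hwy - haff / 2 + s / 2 * dist_sq_sub_dist_sq_eq x y z +
      (1 - s) / 2 * dist_sq_sub_dist_sq_eq w y z
  simp only [dualSlack, smul_eq_mul]
  linear_combination hφ - η z * hst

theorem IsConjugateFunction.convex_contactSet (h : IsConjugateFunction M ψ φ) (hM : Convex ℝ M)
    {z : E} (hz : z ∈ M) : Convex ℝ (contactSet M φ ψ z) := by
  have heq : contactSet M φ ψ z = {x ∈ M | dualSlack φ ψ x z ≤ 0} :=
    Set.ext fun x => and_congr_right fun hx =>
      ⟨le_of_eq, fun hle => hle.antisymm (h.dualSlack_nonneg hx hz)⟩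
  rw [heq]
  exact (h.convexOn_dualSlack hM ψ z).convex_le 0

variable [CompleteSpace E]

theorem isMinOn_of_convexOn_of_hasGradientWithinAt_zero {f : E → ℝ} (hf : ConvexOn ℝ M f)
    {x : E} (hx : x ∈ M) (hgrad : HasGradientWithinAt f 0 M x) : IsMinOn f M x := by
  intro w hw
  have hmaps : MapsTo (AffineMap.lineMap x w : ℝ → E) (Icc 0 1) M := fun t ht =>
    hf.1.segment_subset hx hw (segment_eq_image_lineMap ℝ x w ▸ mem_image_of_mem _ ht)
  have hconv : ConvexOn ℝ (Icc (0 : ℝ) 1) (f ∘ (AffineMap.lineMap x w : ℝ → E)) :=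
    (hf.comp_affineMap (AffineMap.lineMap x w)).subset hmaps (convex_Icc 0 1)
  have hderiv : HasDerivWithinAt (f ∘ (AffineMap.lineMap x w : ℝ → E)) 0 (Icc 0 1) 0 := by
    have hgrad' : HasFDerivWithinAt f (InnerProductSpace.toDual ℝ E 0) M
        ((AffineMap.lineMap x w : ℝ → E) 0) := by simpa using hgrad.hasFDerivWithinAt
    simpa using hgrad'.comp_hasDerivWithinAt (0 : ℝ) AffineMap.hasDerivWithinAt_lineMap hmaps
  have hslope := hconv.le_slope_of_hasDerivWithinAt (y := 1) (by simp) (by simp) one_pos hderiv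
  simpa [slope_def_field] using hslope

theorem hasGradientAt_dist_sq_div_two (p x : E) :
    HasGradientAt (fun w => dist w p ^ 2 / 2) (x - p) x := by
  have h := (((hasStrictFDerivAt_norm_sq (x - p)).hasFDerivAt.comp x
    ((hasFDerivAt_id x).sub_const p)).const_mul (2⁻¹ : ℝ))
  rw [hasGradientAt_iff_hasFDerivAt]
  refine (h.congr_fderiv ?_).congr_of_eventuallyEq (Eventually.of_forall fun w => ?_)
  · ext w
    simp
  · simp [dist_eq_norm, div_eq_inv_mul]

theorem eq_zero_of_isLocalMin_of_hasGradientAt {f : E → ℝ} {v x : E} (hmin : IsLocalMin f x)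
    (hgrad : HasGradientAt f v x) : v = 0 :=
  (InnerProductSpace.toDual ℝ E).map_eq_zero_iff.1
    (hmin.hasFDerivAt_eq_zero hgrad.hasFDerivAt)

/-- The gradient condition makes `x` a critical point of the convex function
`w ↦ dualSlack φ φc w p`, hence a minimizer, and the minimal value is `0`. -/
theorem IsConjugateFunction.dualSlack_eq_zero_of_hasGradientWithinAt
    (hψφ : IsConjugateFunction M ψ φ) (hφφc : IsConjugateFunction M φ φc) (hM : Convex ℝ M)
    {x p : E} (hx : x ∈ M) (hp : p ∈ M) (hgrad : HasGradientWithinAt φ (p - x) M x) :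
    dualSlack φ φc x p = 0 := by
  have hgrad₀ : HasGradientWithinAt (fun w => dualSlack φ φc w p) 0 M x := by
    rw [hasGradientWithinAt_iff_hasFDerivWithinAt] at hgrad ⊢
    refine ((hgrad.add_const (φc p)).add
      (hasGradientAt_dist_sq_div_two p x).hasFDerivAt.hasFDerivWithinAt).congr_fderiv ?_
    rw [← map_add, sub_add_sub_cancel, sub_self]
  have hmin := isMinOn_of_convexOn_of_hasGradientWithinAt_zero
    (hψφ.convexOn_dualSlack hM φc p) hx hgrad₀
  refine le_antisymm ?_ (dualSlack_comm φ φc x p ▸ hφφc.dualSlack_nonneg hp hx)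
  have hφc : φc p ≤ -φ x - dist x p ^ 2 / 2 := hφφc.le_of_forall hp fun w hw => by
    have : dualSlack φ φc x p ≤ dualSlack φ φc w p := hmin hw
    rw [dualSlack, dualSlack] at this
    rw [dist_comm p w]
    linarith
  rw [dualSlack]
  linarith

theorem IsConjugateFunction.eq_of_subset_contactSet (h : IsConjugateFunction M ψ φ) {U : Set E}
    (hU : IsOpen U) {z : E} (hUz : U ⊆ contactSet M φ ψ z) {x y : E} (hx : x ∈ U) (hy : y ∈ M)
    (hxy : dualSlack φ ψ x y = 0) : y = z := by
  have hmin : IsLocalMin (fun w => dist w y ^ 2 / 2 - dist w z ^ 2 / 2) x := by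
    filter_upwards [hU.mem_nhds hx] with w hw
    have hwy := h.dualSlack_nonneg (hUz hw).1 hy
    have hwz := (hUz hw).2
    have hxz := (hUz hx).2
    rw [dualSlack] at hxy hwy hwz hxz
    linarith
  have hgrad : HasGradientAt (fun w => dist w y ^ 2 / 2 - dist w z ^ 2 / 2)
      ((x - y) - (x - z)) x := by
    rw [hasGradientAt_iff_hasFDerivAt, map_sub]
    exact (hasGradientAt_dist_sq_div_two y x).hasFDerivAt.sub
      (hasGradientAt_dist_sq_div_two z x).hasFDerivAt
  have := eq_zero_of_isLocalMin_of_hasGradientAt hmin hgrad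
  rw [sub_sub_sub_cancel_left] at this
  exact (sub_eq_zero.1 this).symm

theorem eq_add_gradient_sqDistConjugate [CompactSpace M] {ψ : C(M, ℝ)} {x : E}
    (hd : DifferentiableAt ℝ (sqDistConjugate ψ) x) {y : M}
    (hy : dist x y ^ 2 / 2 + ψ y = -sqDistConjugate ψ x) :
    (y : E) = x + gradient (sqDistConjugate ψ) x := by
  have hmin : IsLocalMin (fun w => sqDistConjugate ψ w + dist w y ^ 2 / 2) x :=
    Eventually.of_forall fun w => by linarith [neg_sqDistConjugate_le ψ w y]
  have hgrad : HasGradientAt (fun w => sqDistConjugate ψ w + dist w y ^ 2 / 2)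
      (gradient (sqDistConjugate ψ) x + (x - y)) x := by
    rw [hasGradientAt_iff_hasFDerivAt, map_add]
    exact hd.hasGradientAt.hasFDerivAt.add (hasGradientAt_dist_sq_div_two (y : E) x).hasFDerivAt
  have := eq_zero_of_isLocalMin_of_hasGradientAt hmin hgrad
  rw [← sub_eq_zero, ← neg_eq_zero, ← this]
  abel

end InnerProductSpace

section Brenier

variable {E : Type*} [NormedAddCommGroup E] [InnerProductSpace ℝ E]

/-- The map `exp (∇f)`, where `exp_x v = x + v`. It is the identity wherever `f` is not
differentiable. -/
noncomputable def expGradient [CompleteSpace E] (f : E → ℝ) (x : E) : E :=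
  x + gradient f x

theorem hasGradientWithinAt_expGradient_sub [CompleteSpace E] {f : E → ℝ} {x : E}
    (hd : DifferentiableAt ℝ f x) (s : Set E) :
    HasGradientWithinAt f (expGradient f x - x) s x := by
  rw [expGradient, add_sub_cancel_left]
  exact hd.hasGradientAt.hasFDerivAt.hasFDerivWithinAt

variable [FiniteDimensional ℝ E] [MeasurableSpace E] [BorelSpace E]

theorem measurable_expGradient (f : E → ℝ) : Measurable (expGradient f) :=
  measurable_id.add
    ((InnerProductSpace.toDual ℝ E).symm.continuous.measurable.comp (measurable_fderiv ℝ f))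

variable {M : Set E} [CompactSpace M] [Nonempty M] {m μ ρ : Measure E} [ρ.IsAddHaarMeasure]

theorem ae_differentiableAt_sqDistConjugate (hac : m ≪ ρ) (ψ : C(M, ℝ)) :
    ∀ᵐ x ∂m, DifferentiableAt ℝ (sqDistConjugate ψ) x := by
  refine hac.ae_le ?_
  have hball : ∀ k : ℕ, ∀ᵐ x ∂ρ, x ∈ Metric.ball (0 : E) k →
      DifferentiableWithinAt ℝ (sqDistConjugate ψ) (Metric.ball 0 k) x := fun k =>
    have ⟨_, hR⟩ := exists_lipschitzOnWith_sqDistConjugate (M := M)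
      (Metric.isBounded_ball (x := (0 : E)) (r := k))
    (hR ψ).ae_differentiableWithinAt_of_mem
  filter_upwards [ae_all_iff.2 hball] with x hx
  obtain ⟨k, hk⟩ := exists_nat_gt ‖x‖
  have hxk : x ∈ Metric.ball (0 : E) k := mem_ball_zero_iff.2 hk
  exact (hx k hxk).differentiableAt (Metric.isOpen_ball.mem_nhds hxk)

/-- Brenier's theorem. -/
theorem exists_map_expGradient_eq [IsProbabilityMeasure m] [IsProbabilityMeasure μ]
    (hac : m ≪ ρ) (hm : m Mᶜ = 0) (hμ : μ Mᶜ = 0) :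
    ∃ ψ : C(M, ℝ), m.map (expGradient (sqDistConjugate ψ)) = μ := by
  have hμM : ∀ᵐ y ∂μ, y ∈ range (Subtype.val : M → E) := by
    rw [Subtype.range_val]
    exact mem_ae_iff.2 hμ
  have hemb : MeasurableEmbedding (Subtype.val : M → E) := MeasurableEmbedding.subtype_coe
    (isCompact_iff_compactSpace.2 ‹CompactSpace M›).measurableSet
  have : IsProbabilityMeasure (μ.comap (Subtype.val : M → E)) := hemb.isProbabilityMeasure_comap hμM
  obtain ⟨ψ, hψ⟩ := exists_dualObjective_minimizer hm (μ.comap (Subtype.val : M → E))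
  refine ⟨ψ, ?_⟩
  rw [map_eq_of_dualObjective_minimizer hm hψ (measurable_expGradient _), hemb.map_comap,
    Measure.restrict_eq_self_of_ae_mem hμM]
  filter_upwards [ae_differentiableAt_sqDistConjugate hac ψ] with x hx y hy
  exact eq_add_gradient_sqDistConjugate hx hy

end Brenier

section OpenConvexSubset

theorem continuous_measureReal_setOf_lt {Ω : Type*} [MeasurableSpace Ω] {P : Measure Ω}
    [IsFiniteMeasure P] {f : Ω → ℝ} (hf : Measurable f) (hnull : ∀ r, P {ω | f ω = r} = 0) :
    Continuous fun r => P.real {ω | f ω < r} := by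
  have hmeas (r : ℝ) : MeasurableSet {ω | f ω < r} := measurableSet_lt hf measurable_const
  simp only [← integral_indicator_one (hmeas _)]
  refine continuous_iff_continuousAt.2 fun r => continuousAt_of_dominated (bound := fun _ => 1)
    (Eventually.of_forall fun s =>
      (measurable_one.indicator (hmeas s)).aestronglyMeasurable)
    (Eventually.of_forall fun s => Eventually.of_forall fun ω =>
      (norm_indicator_le_norm_self _ _).trans_eq norm_one)
    (integrable_const _) ?_
  filter_upwards [compl_mem_ae_iff.2 (hnull r)] with ω hω
  obtain hlt | hgt := lt_or_gt_of_ne (show f ω ≠ r from hω)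
  · refine continuousAt_const.congr (f := fun _ => (1 : ℝ)) ?_
    filter_upwards [lt_mem_nhds hlt] with s hs
    exact (indicator_of_mem (s := {ω | f ω < s}) hs 1).symm
  · refine continuousAt_const.congr (f := fun _ => (0 : ℝ)) ?_
    filter_upwards [gt_mem_nhds hgt] with s hs
    exact (indicator_of_notMem (s := {ω | f ω < s}) hs.not_gt 1).symm

variable {E : Type*} [NormedAddCommGroup E] [NormedSpace ℝ E] [FiniteDimensional ℝ E]
  [MeasurableSpace E] [BorelSpace E] [Nontrivial E] {m ρ : Measure E} [ρ.IsAddHaarMeasure]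

theorem continuous_measureReal_inter_ball [IsFiniteMeasure m] (hac : m ≪ ρ) (s : Set E) :
    Continuous fun r => m.real (s ∩ Metric.ball 0 r) := by
  have hsphere (r : ℝ) : m.restrict s {x | ‖x‖ = r} = 0 :=
    Measure.absolutelyContinuous_of_le Measure.restrict_le_self (hac (by
      simpa [Metric.sphere] using Measure.addHaar_sphere ρ (0 : E) r))
  refine (continuous_measureReal_setOf_lt measurable_norm hsphere).congr fun r => ?_
  rw [measureReal_restrict_apply (measurableSet_lt measurable_norm measurable_const), inter_comm]
  congr 2
  ext x
  simp

theorem exists_isOpen_convex_subset_measure_eq [IsFiniteMeasure m] (hac : m ≪ ρ) {C : Set E}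
    (hC : Convex ℝ C) (hCb : Bornology.IsBounded C) {c : ℝ≥0∞} (hc : c ≤ m C) :
    ∃ U ⊆ C, IsOpen U ∧ Convex ℝ U ∧ m U = c := by
  have hint : m (interior C) = m C :=
    (interior_ae_eq_of_null_frontier (hac (hC.addHaar_frontier ρ))).measure_eq
  obtain ⟨R, hR₀, hR⟩ := (hCb.subset interior_subset).subset_ball_lt 0 0
  have hmem : c.toReal ∈ Icc (m.real (interior C ∩ Metric.ball 0 0))
      (m.real (interior C ∩ Metric.ball 0 R)) := by
    rw [inter_eq_left.2 hR, Metric.ball_zero, inter_empty, measureReal_empty, measureReal_def, hint]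
    exact ⟨ENNReal.toReal_nonneg, ENNReal.toReal_mono (measure_ne_top m C) hc⟩
  obtain ⟨r, -, hr⟩ := intermediate_value_Icc hR₀.le
    (continuous_measureReal_inter_ball hac (interior C)).continuousOn hmem
  exact ⟨interior C ∩ Metric.ball 0 r, inter_subset_left.trans interior_subset,
    isOpen_interior.inter Metric.isOpen_ball, hC.interior.inter (convex_ball 0 r),
    (ENNReal.toReal_eq_toReal_iff' (measure_ne_top _ _)
      (ne_top_of_le_ne_top (measure_ne_top m C) hc)).1 hr⟩

end OpenConvexSubset

section ContactSet

variable {E : Type*} [NormedAddCommGroup E] [InnerProductSpace ℝ E] [CompleteSpace E]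
  [MeasurableSpace E] [BorelSpace E] {M U : Set E} {m : Measure E}
  {φ φc : E → ℝ} {T gc : E → E} {z : E}

namespace IsDualCertificate

theorem ae_restrict_eq (h : IsDualCertificate M m φ φc T) (hU : IsOpen U)
    (hUz : U ⊆ contactSet M φ φc z) : ∀ᵐ x ∂(m.restrict U), T x = z := by
  filter_upwards [ae_restrict_mem hU.measurableSet, ae_restrict_of_ae h.dualSlack_eq_zero]
    with x hx hslack
  exact h.isConjugateFunction_left.eq_of_subset_contactSet hU hUz hx
    (h.mapsTo (hUz hx).1) hslack

end IsDualCertificate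

theorem IsConjugateFunction.map_apply_eq_zero_of_subset_contactSet
    (h : IsConjugateFunction M φc φ) (hU : IsOpen U) (hUz : U ⊆ contactSet M φ φc z)
    (hm : m Mᶜ = 0) (hmz : m {z} = 0) (hgc : Measurable gc)
    (hslack : ∀ᵐ x ∂m, gc x ∈ M → dualSlack φ φc (gc x) x = 0) : m.map gc U = 0 := by
  rw [Measure.map_apply hgc hU.measurableSet]
  refine measure_mono_null_ae ?_ hmz
  filter_upwards [hslack, mem_ae_iff.2 hm] with x hx hxM hxU
  exact h.eq_of_subset_contactSet hU hUz hxU hxM (hx (hUz hxU).1)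

end ContactSet

section ConjugateMeasure

variable {n : ℕ} {M : Set (EuclideanSpace ℝ (Fin n))}
  {m μ μc ρ : Measure (EuclideanSpace ℝ (Fin n))}

theorem exists_isConjugateMeasure [CompactSpace M] [Nonempty M] [ρ.IsAddHaarMeasure]
    [IsProbabilityMeasure m] [IsProbabilityMeasure μ] (hac : m ≪ ρ) (hm : m Mᶜ = 0)
    (hμ : μ Mᶜ = 0) : ∃ μc, IsConjugateMeasure M m μ μc := by
  obtain ⟨ψ, hψ⟩ := exists_map_expGradient_eq hac hm hμ
  have hgrad (ψ : C(M, ℝ)) : IsExpGradient M m (sqDistConjugate ψ)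
      (expGradient (sqDistConjugate ψ)) := by
    filter_upwards [ae_differentiableAt_sqDistConjugate hac ψ] with x hx
    exact hasGradientWithinAt_expGradient_sub hx M
  exact ⟨m.map (expGradient (sqDistConjugate (sqDistConjugateOn ψ))), sqDistConjugate ψ,
    sqDistConjugate (sqDistConjugateOn ψ), expGradient (sqDistConjugate ψ), _,
    ⟨Function.extend Subtype.val ψ 0, isConjugateFunction_sqDistConjugate fun y =>
      Subtype.val_injective.extend_apply ψ 0 y⟩,
    isConjugateFunction_sqDistConjugate fun _ => rfl,
    measurable_expGradient _, hgrad ψ, hψ, measurable_expGradient _, hgrad _, rfl⟩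

theorem IsConjugateMeasure.exists_isDualCertificate (h : IsConjugateMeasure M m μ μc)
    (hM : Convex ℝ M) (hne : M.Nonempty) (hm : m Mᶜ = 0)
    (hμ : μ Mᶜ = 0) :
    ∃ φ φc T gc, IsDualCertificate M m φ φc T ∧ m.map T = μ ∧
      Measurable gc ∧ m.map gc = μc ∧
      ∀ᵐ x ∂m, gc x ∈ M → dualSlack φ φc (gc x) x = 0 := by
  obtain ⟨φ, φc, g, gc, ⟨ψ, hψφ⟩, hφφc, hg, hgφ, rfl, hgc, hgcφ, rfl⟩ := h
  have hφcφ := hψφ.biconjugate hφφc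
  have hgM : ∀ᵐ x ∂m, g x ∈ M := ae_of_ae_map hg.aemeasurable (mem_ae_iff.2 hμ)
  obtain ⟨T, hT, hTM, hgT⟩ := hg.aemeasurable.exists_ae_eq_range_subset hgM hne
  refine ⟨φ, φc, T, gc, ⟨hφcφ, hφφc, hT, fun x _ => hTM (mem_range_self x), ?_⟩,
    (Measure.map_congr hgT).symm, hgc, rfl, ?_⟩
  · filter_upwards [hgT, hgM, hgφ, mem_ae_iff.2 hm] with x hx hgx hgrad hxM
    rw [← hx]
    exact hψφ.dualSlack_eq_zero_of_hasGradientWithinAt hφφc hM hxM hgx hgrad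
  · filter_upwards [hgcφ, mem_ae_iff.2 hm] with x hgrad hxM hgx
    rw [dualSlack_comm]
    exact hφφc.dualSlack_eq_zero_of_hasGradientWithinAt hφcφ hM hxM hgx hgrad

theorem IsConjugateMeasure.apply_eq_zero [IsFiniteMeasure m] (h : IsConjugateMeasure M m μ μc)
    (hMc : IsCompact M) (hM : Convex ℝ M) (hm : m Mᶜ = 0) (hμ : μ Mᶜ = 0)
    {z : EuclideanSpace ℝ (Fin n)} (hz : z ∈ M) (hmz : m {z} = 0)
    {U : Set (EuclideanSpace ℝ (Fin n))} (hU : IsOpen U) (hUM : U ⊆ M) (hUm : U ⊆ m.support)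
    (hopt : ∀ g, IsOptimalTransportMap M m g → m.map g = μ → ∀ᵐ x ∂(m.restrict U), g x = z) :
    μc U = 0 := by
  obtain ⟨φ, φc, T, gc, hT, hTμ, hgc, rfl, hslack⟩ :=
    h.exists_isDualCertificate hM ⟨z, hz⟩ hm hμ
  have hUz : U ⊆ contactSet M φ φc z := hT.subset_contactSet hMc.isBounded hU hUM hUm
    (hopt T (hT.isOptimalTransportMap hMc hm) hTμ)
  exact hT.isConjugateFunction_left.map_apply_eq_zero_of_subset_contactSet hU hUz hm hmz hgc
    hslack

end ConjugateMeasure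

theorem isProbabilityMeasure_ofReal_smul_add_ofReal_smul {Ω : Type*} [MeasurableSpace Ω]
    {P Q : Measure Ω} [IsProbabilityMeasure P] [IsProbabilityMeasure Q] {t : ℝ}
    (ht : t ∈ Icc (0 : ℝ) 1) :
    IsProbabilityMeasure (ENNReal.ofReal t • P + ENNReal.ofReal (1 - t) • Q) :=
  ⟨by simp [← ENNReal.ofReal_add ht.1 (sub_nonneg.2 ht.2)]⟩

theorem lemma4p1 {n : ℕ} (hn : 1 ≤ n)
    (M : Set (EuclideanSpace ℝ (Fin n))) (hMc : IsCompact M) (hMconv : Convex ℝ M)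
    (m : Measure (EuclideanSpace ℝ (Fin n))) [IsProbabilityMeasure m]
    (hac : m ≪ volume) (hsupp : m.support = M)
    (lam : ℝ) (hlam : lam ∈ Set.Icc (0 : ℝ) 1)
    (z : EuclideanSpace ℝ (Fin n)) (hz : z ∈ M)
    (ν : Measure (EuclideanSpace ℝ (Fin n))) [IsProbabilityMeasure ν] (hν : ν Mᶜ = 0)
    (μ : Measure (EuclideanSpace ℝ (Fin n)))
    (hμ : μ = ENNReal.ofReal lam • Measure.dirac z + ENNReal.ofReal (1 - lam) • ν) :
    (∃ g, IsOptimalTransportMap M m g ∧ m.map g = μ) ∧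
    (∃ μc, IsConjugateMeasure M m μ μc) ∧
    ∃ U : Set (EuclideanSpace ℝ (Fin n)),
      IsOpen U ∧ Convex ℝ U ∧ U ⊆ M ∧ m U = ENNReal.ofReal lam ∧
      (∀ g, IsOptimalTransportMap M m g → m.map g = μ → ∀ᵐ x ∂(m.restrict U), g x = z) ∧
      (∀ μc, IsConjugateMeasure M m μ μc → μc U = 0) := by
  have : Nonempty (Fin n) := ⟨⟨0, hn⟩⟩
  have : CompactSpace M := isCompact_iff_compactSpace.1 hMc
  have : Nonempty M := ⟨⟨z, hz⟩⟩
  have hm : m Mᶜ = 0 := hsupp ▸ Measure.measure_compl_support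
  have hμM : μ Mᶜ = 0 := by
    simp [hμ, hν, Measure.dirac_apply' z hMc.measurableSet.compl, hz]
  have : IsProbabilityMeasure μ := hμ ▸ isProbabilityMeasure_ofReal_smul_add_ofReal_smul hlam
  have hμz : ENNReal.ofReal lam ≤ μ {z} := by simp [hμ]
  obtain ⟨μc, hμc⟩ := exists_isConjugateMeasure hac hm hμM
  obtain ⟨φ, φc, T, -, hT, hTμ, -⟩ := hμc.exists_isDualCertificate hMconv ⟨z, hz⟩ hm hμM
  obtain ⟨U, hUz, hUo, hUconv, hUm⟩ := exists_isOpen_convex_subset_measure_eq hac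
    (hT.isConjugateFunction_left.convex_contactSet hMconv hz)
    (hMc.isBounded.subset (sep_subset M _)) (hμz.trans (hTμ ▸ hT.map_singleton_le hm))
  have hUM : U ⊆ M := hUz.trans (sep_subset M _)
  have hopt (g) (hg : IsOptimalTransportMap M m g) (hgμ : m.map g = μ) :
      ∀ᵐ x ∂(m.restrict U), g x = z :=
    (hT.of_isOptimalTransportMap hMc hm hg (hgμ.trans hTμ.symm)).ae_restrict_eq hUo hUz
  exact ⟨⟨T, hT.isOptimalTransportMap hMc hm, hTμ⟩, ⟨μc, hμc⟩, U, hUo, hUconv, hUM, hUm, hopt,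
    fun _ h => h.apply_eq_zero hMc hMconv hm hμM hz (hac (measure_singleton z)) hUo hUM
      (hsupp ▸ hUM) hopt⟩
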